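/- Let $k<n$ be positive integers. Let $\mathrm{Gr}(k,n)$ be the Grassmannian of $k$-dimensional linear subspaces of $\mathbb{R}^n$ and let $\mathrm{Graff}(k,n)$ be the Grassmannian of $k$-dimensional affine subspaces of $\mathbb{R}^n$, whose points are written $\mathbb{A}+b$ with $\mathbb{A}\in\mathrm{Gr}(k,n)$ and $b\in\mathbb{R}^n$. Both are smooth manifolds through graph coordinates: given a linear isomorphism $\varphi:\mathbb{R}^k\times\mathbb{R}^{n-k}\to\mathbb{R}^n$, the matrix $X\in\mathbb{R}^{(n-k)\times k}$ is the coordinate of the plane $\{\varphi(u,Xu):u\in\mathbb{R}^k\}$, and $(X,y)\in\mathbb{R}^{(n-k)\times k}\times\mathbb{R}^{n-k}$ are the coordinates of the flat $\{\varphi(u,Xu+y):u\in\mathbb{R}^k\}$. Let $\tau:\mathrm{Graff}(k,n)\to\mathrm{Gr}(k,n)$, $\mathbb{A}+b\mapsto\mathbb{A}$, be the deaffine map. Give each fiber $\tau^{-1}(\mathbb{A})=\{\mathbb{A}+b: b\in\mathbb{R}^n\}$ the vector space structure of $\mathbb{R}^n/\mathbb{A}$, i.e., $(\mathbb{A}+b)+(\mathbb{A}+c)=\mathbb{A}+(b+c)$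 and $r(\mathbb{A}+b)=\mathbb{A}+rb$. (i) $\mathrm{Graff}(k,n)$ is a smooth real vector bundle of rank $n-k$ over $\mathrm{Gr}(k,n)$ with bundle projection $\tau$; the smooth structure of the total space of this bundle is that of the manifold $\mathrm{Graff}(k,n)$. (ii) $\mathrm{Graff}(k,n)$ is the universal quotient bundle of $\mathrm{Gr}(k,n)$: the tautological bundle $S=\{(\mathbb{A},v)\in\mathrm{Gr}(k,n)\times\mathbb{R}^n: v\in\mathbb{A}\}$, with the subspace topology, is a smooth vector bundle of rank $k$ over $\mathrm{Gr}(k,n)$, and $$0\to S\to \mathrm{Gr}(k,n)\times\mathbb{R}^n\to\mathrm{Graff}(k,n)\to 0,$$ where the first map is the inclusion and the second is $(\mathbb{A},b)\mapsto\mathbb{A}+b$, is a short exact sequence of smooth vector bundles over $\mathrm{Gr}(k,n)$, i.e., both maps are smooth, linear on fibers, and cover the identity of $\mathrm{Gr}(k,n)$, and the sequence is exact on every fiber. -/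

import Mathlib

open Bundle Manifold Set Module
open scoped ContDiff

noncomputable section

namespace AffineGrassmannian

/-- `m`-dimensional Euclidean space. -/
abbrev EV (m : ℕ) : Type := EuclideanSpace ℝ (Fin m)

/-! ## The Grassmannian and the affine Grassmannian as sets -/

/-- The Grassmannian `Gr(k,n)`: the `k`-dimensional linear subspaces of `ℝⁿ`. -/
@[ext]
structure Gr (k n : ℕ) where
  /-- the underlying linear subspace -/
  plane : Submodule ℝ (EV n)
  finrank_plane : finrank ℝ plane = k

/-- The affine Grassmannian `Graff(k,n)`: the (nonempty) `k`-dimensional affine subspaces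
of `ℝⁿ`. -/
@[ext]
structure Graff (k n : ℕ) where
  /-- the underlying affine subspace -/
  flat : AffineSubspace ℝ (EV n)
  nonempty_flat : (flat : Set (EV n)).Nonempty
  finrank_direction : finrank ℝ flat.direction = k

variable {k n : ℕ}

/-- The deaffine map `τ : Graff(k,n) → Gr(k,n)`, `A + b ↦ A`. -/
def deaffine (L : Graff k n) : Gr k n := ⟨L.flat.direction, L.finrank_direction⟩

/-- The affine subspace `A + b`. -/
def translate (A : Gr k n) (b : EV n) : Graff k n where
  flat := AffineSubspace.mk' b A.plane
  nonempty_flat := ⟨b, AffineSubspace.self_mem_mk' b A.plane⟩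
  finrank_direction := by rw [AffineSubspace.direction_mk']; exact A.finrank_plane

theorem deaffine_translate (A : Gr k n) (b : EV n) : deaffine (translate A b) = A :=
  Gr.ext (AffineSubspace.direction_mk' b A.plane)

theorem translate_eq_iff (A B : Gr k n) (b c : EV n) :
    translate A b = translate B c ↔ A = B ∧ b - c ∈ B.plane := by
  constructor
  · intro h
    have h1 : A = B := by rw [← deaffine_translate A b, h, deaffine_translate]
    refine ⟨h1, ?_⟩
    have h2 : b ∈ (translate B c).flat := by
      rw [← h]; exact AffineSubspace.self_mem_mk' b A.plane
    exact h2
  · rintro ⟨rfl, h⟩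
    refine Graff.ext (AffineSubspace.ext_of_direction_eq ?_ ⟨b, ?_, ?_⟩)
    · exact (AffineSubspace.direction_mk' _ _).trans (AffineSubspace.direction_mk' _ _).symm
    · exact AffineSubspace.self_mem_mk' b A.plane
    · exact h

theorem exists_translate (L : Graff k n) : ∃ b, translate (deaffine L) b = L := by
  obtain ⟨b, hb⟩ := L.nonempty_flat
  exact ⟨b, Graff.ext (AffineSubspace.mk'_eq hb)⟩

/-! ## Smooth structures

A set covered by the images of injective parametrizations by a normed space, all of whose changes
of parameters are smooth on open domains, is a smooth manifold. -/

section Param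

variable {H : Type} [NormedAddCommGroup H] [NormedSpace ℝ H] {M ι : Type}

/-- The chart inverse to an injective parametrization `p : H → M`; its domain is the image of
`p`. -/
def chartOfParam (p : H → M) (hp : Function.Injective p) : PartialEquiv M H where
  toFun := Function.invFun p
  invFun := p
  source := range p
  target := univ
  map_source' _ _ := mem_univ _
  map_target' h _ := mem_range_self h
  left_inv' := by rintro _ ⟨h, rfl⟩; rw [Function.leftInverse_invFun hp]
  right_inv' h _ := Function.leftInverse_invFun hp h

/-- The atlas whose charts are inverse to the given parametrizations. -/
@[reducible]
def coreOfParam (p : ι → H → M) (hp : ∀ i, Function.Injective (p i))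
    (hcov : ∀ x, ∃ i, x ∈ range (p i))
    (hopen : ∀ i j, IsOpen {h | p i h ∈ range (p j)})
    (hsmooth : ∀ i j,
      ContDiffOn ℝ ∞ (fun h => Function.invFun (p j) (p i h)) {h | p i h ∈ range (p j)}) :
    ChartedSpaceCore H M where
  atlas := range fun i => chartOfParam (p i) (hp i)
  chartAt x := chartOfParam (p (hcov x).choose) (hp _)
  mem_chart_source x := (hcov x).choose_spec
  chart_mem_atlas x := mem_range_self _
  open_source := by
    rintro _ _ ⟨i, rfl⟩ ⟨j, rfl⟩
    have h : ((chartOfParam (p i) (hp i)).symm.trans (chartOfParam (p j) (hp j))).source =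
        {h | p i h ∈ range (p j)} := univ_inter _
    rw [h]
    exact hopen i j
  continuousOn_toFun := by
    rintro _ _ ⟨i, rfl⟩ ⟨j, rfl⟩
    exact (hsmooth i j).continuousOn.mono fun x hx => hx.2

theorem isManifold_coreOfParam (p : ι → H → M) (hp : ∀ i, Function.Injective (p i))
    (hcov : ∀ x, ∃ i, x ∈ range (p i))
    (hopen : ∀ i j, IsOpen {h | p i h ∈ range (p j)})
    (hsmooth : ∀ i j,
      ContDiffOn ℝ ∞ (fun h => Function.invFun (p j) (p i h)) {h | p i h ∈ range (p j)}) :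
    letI := (coreOfParam p hp hcov hopen hsmooth).toTopologicalSpace
    letI := (coreOfParam p hp hcov hopen hsmooth).toChartedSpace
    IsManifold 𝓘(ℝ, H) ∞ M := by
  let := (coreOfParam p hp hcov hopen hsmooth).toTopologicalSpace
  let := (coreOfParam p hp hcov hopen hsmooth).toChartedSpace
  refine isManifold_of_contDiffOn 𝓘(ℝ, H) ∞ M ?_
  intro e e' he he'
  obtain ⟨_, ⟨_, rfl⟩, he⟩ := he
  obtain ⟨_, ⟨_, rfl⟩, he'⟩ := he'
  obtain ⟨_, ⟨⟨i, rfl⟩, rfl⟩, rfl⟩ := he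
  obtain ⟨_, ⟨⟨j, rfl⟩, rfl⟩, rfl⟩ := he'
  refine (hsmooth i j).congr_mono (fun x _ => rfl) ?_
  intro x hx
  exact hx.1.2

end Param

/-- A linear coordinate system of `ℝⁿ`, split into `k` and `n - k` coordinates. -/
abbrev Splitting (k n : ℕ) : Type := (EV k × EV (n - k)) ≃L[ℝ] EV n

/-- The model space of `Gr(k,n)`: the linear maps `ℝᵏ → ℝⁿ⁻ᵏ`. -/
abbrev GrModel (k n : ℕ) : Type := EV k →L[ℝ] EV (n - k)

/-- The model space of `Graff(k,n)`: the affine maps `u ↦ X u + y` from `ℝᵏ` to `ℝⁿ⁻ᵏ`. -/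
abbrev GraffModel (k n : ℕ) : Type := GrModel k n × EV (n - k)

/-- The `k`-plane that is the graph of `X : ℝᵏ → ℝⁿ⁻ᵏ` in the coordinates `φ`. -/
def graphPlane (φ : Splitting k n) (X : GrModel k n) : Gr k n where
  plane := (LinearMap.graph X.toLinearMap).map φ.toLinearEquiv.toLinearMap
  finrank_plane := by
    have h1 : finrank ℝ ((LinearMap.graph X.toLinearMap).map φ.toLinearEquiv.toLinearMap)
        = finrank ℝ (LinearMap.graph X.toLinearMap) :=
      LinearEquiv.finrank_map_eq φ.toLinearEquiv _
    rw [h1, LinearMap.graph_eq_range_prod,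
      LinearMap.finrank_range_of_inj (f := LinearMap.id.prod X.toLinearMap)]
    · simp
    · intro u v h
      exact congrArg Prod.fst h

/-- The `k`-flat that is the graph of `u ↦ X u + y` in the coordinates `φ`. -/
def graphFlat (φ : Splitting k n) (Xy : GraffModel k n) : Graff k n :=
  translate (graphPlane φ Xy.1) (φ (0, Xy.2))

theorem mem_graphPlane (φ : Splitting k n) (X : GrModel k n) (v : EV n) :
    v ∈ (graphPlane φ X).plane ↔ (φ.symm v).2 = X (φ.symm v).1 := by
  constructor
  · rintro ⟨w, hw, rfl⟩
    have h : φ.symm (φ.toLinearEquiv.toLinearMap w) = w := φ.symm_apply_apply w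
    rw [h]
    exact hw
  · intro h
    exact ⟨φ.symm v, h, φ.apply_symm_apply v⟩

theorem graphPlane_injective (φ : Splitting k n) : Function.Injective (graphPlane φ) := by
  intro X Y h
  ext1 u
  have h1 : φ (u, X u) ∈ (graphPlane φ X).plane := by rw [mem_graphPlane]; simp
  rw [h, mem_graphPlane] at h1
  simpa using h1

theorem graphFlat_eq_iff (φ ψ : Splitting k n) (p q : GraffModel k n) :
    graphFlat φ p = graphFlat ψ q ↔ graphPlane φ p.1 = graphPlane ψ q.1 ∧
      (ψ.symm (φ (0, p.2))).2 = q.1 (ψ.symm (φ (0, p.2))).1 + q.2 := by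
  rw [graphFlat, graphFlat, translate_eq_iff, mem_graphPlane]
  simp [map_sub, sub_eq_iff_eq_add]

theorem graphFlat_injective (φ : Splitting k n) : Function.Injective (graphFlat φ) := by
  rintro ⟨X, y⟩ ⟨X', y'⟩ h
  rw [graphFlat_eq_iff] at h
  have h1 : X = X' := graphPlane_injective φ h.1
  have h2 : y = y' := by simpa using h.2
  rw [h1, h2]

theorem exists_graphPlane (A : Gr k n) : ∃ φ : Splitting k n, A ∈ range (graphPlane φ) := by
  have hA := A.finrank_plane
  have hperp : finrank ℝ A.planeᗮ = n - k := by
    have := A.plane.finrank_add_finrank_orthogonal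
    rw [hA, finrank_euclideanSpace_fin] at this
    omega
  let e1 : EV k ≃ₗ[ℝ] A.plane := LinearEquiv.ofFinrankEq _ _ (by simp [hA])
  let e2 : EV (n - k) ≃ₗ[ℝ] A.planeᗮ := LinearEquiv.ofFinrankEq _ _ (by simp [hperp])
  let f := (e1.prodCongr e2).trans
    (Submodule.prodEquivOfIsCompl A.plane A.planeᗮ (Submodule.isCompl_orthogonal A.plane))
  let φ : Splitting k n := f.toContinuousLinearEquiv
  refine ⟨φ, 0, Gr.ext ?_⟩
  refine Submodule.eq_of_le_of_finrank_eq ?_ ((graphPlane φ 0).finrank_plane.trans hA.symm)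
  rintro _ ⟨⟨u, w⟩, hw, rfl⟩
  have hw0 : w = 0 := hw
  subst hw0
  have : φ.toLinearEquiv.toLinearMap (u, 0) = (e1 u : EV n) := by
    change f (u, 0) = _
    simp [f]
  rw [this]
  exact (e1 u).2

theorem exists_graphFlat (L : Graff k n) : ∃ φ : Splitting k n, L ∈ range (graphFlat φ) := by
  obtain ⟨φ, X, hX⟩ := exists_graphPlane (deaffine L)
  obtain ⟨b, hb⟩ := exists_translate L
  refine ⟨φ, (X, (φ.symm b).2 - X (φ.symm b).1), ?_⟩
  rw [graphFlat, ← hb, translate_eq_iff, ← hX, mem_graphPlane]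
  simp [map_sub]

/-- First component of the change of coordinates on a graph. -/
def transFst (φ ψ : Splitting k n) (X : GrModel k n) : EV k →L[ℝ] EV k :=
  ((ContinuousLinearMap.fst ℝ _ _).comp (φ.trans ψ.symm).toContinuousLinearMap).comp
    (ContinuousLinearMap.inl ℝ _ _ + (ContinuousLinearMap.inr ℝ _ _).comp X)

/-- Second component of the change of coordinates on a graph. -/
def transSnd (φ ψ : Splitting k n) (X : GrModel k n) : EV k →L[ℝ] EV (n - k) :=
  ((ContinuousLinearMap.snd ℝ _ _).comp (φ.trans ψ.symm).toContinuousLinearMap).comp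
    (ContinuousLinearMap.inl ℝ _ _ + (ContinuousLinearMap.inr ℝ _ _).comp X)

theorem transFst_apply (φ ψ : Splitting k n) (X : GrModel k n) (u : EV k) :
    transFst φ ψ X u = (ψ.symm (φ (u, X u))).1 := by
  have h : (u, X u) = (u, 0) + (0, X u) := by simp
  rw [h]
  simp [transFst, -Prod.mk_add_mk]

theorem transSnd_apply (φ ψ : Splitting k n) (X : GrModel k n) (u : EV k) :
    transSnd φ ψ X u = (ψ.symm (φ (u, X u))).2 := by
  have h : (u, X u) = (u, 0) + (0, X u) := by simp
  rw [h]
  simp [transSnd, -Prod.mk_add_mk]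

theorem contDiff_transFst (φ ψ : Splitting k n) : ContDiff ℝ ∞ (transFst φ ψ) :=
  contDiff_const.clm_comp (contDiff_const.add (contDiff_const.clm_comp contDiff_id))

theorem contDiff_transSnd (φ ψ : Splitting k n) : ContDiff ℝ ∞ (transSnd φ ψ) :=
  contDiff_const.clm_comp (contDiff_const.add (contDiff_const.clm_comp contDiff_id))

theorem graphPlane_eq_iff (φ ψ : Splitting k n) (X Y : GrModel k n) :
    graphPlane ψ Y = graphPlane φ X ↔ transSnd φ ψ X = Y.comp (transFst φ ψ X) := by
  constructor
  · intro h
    ext1 u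
    have h1 : φ (u, X u) ∈ (graphPlane φ X).plane := by rw [mem_graphPlane]; simp
    rw [← h, mem_graphPlane] at h1
    rw [transSnd_apply, h1, ContinuousLinearMap.comp_apply, transFst_apply]
  · intro h
    refine Gr.ext (Submodule.eq_of_le_of_finrank_eq ?_
      ((graphPlane φ X).finrank_plane.trans (graphPlane ψ Y).finrank_plane.symm)).symm
    rintro _ ⟨⟨u, w⟩, hw, rfl⟩
    have hw0 : w = X u := hw
    subst hw0
    rw [mem_graphPlane]
    have := congrArg (fun f => f u) h
    simpa [transSnd_apply, transFst_apply] using this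

theorem graphPlane_mem_range_iff (φ ψ : Splitting k n) (X : GrModel k n) :
    graphPlane φ X ∈ range (graphPlane ψ) ↔ IsUnit (transFst φ ψ X) := by
  constructor
  · rintro ⟨Y, hY⟩
    rw [graphPlane_eq_iff] at hY
    have hinj : Function.Injective (transFst φ ψ X) := by
      rw [injective_iff_map_eq_zero]
      intro u hu
      have h2 : transSnd φ ψ X u = 0 := by rw [hY, ContinuousLinearMap.comp_apply, hu, map_zero]
      rw [transFst_apply] at hu
      rw [transSnd_apply] at h2
      have h3 : ψ.symm (φ (u, X u)) = 0 := Prod.ext hu h2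
      have h4 : (u, X u) = 0 := by simpa using h3
      exact congrArg Prod.fst h4
    rw [ContinuousLinearMap.isUnit_iff_bijective]
    exact ⟨hinj, LinearMap.injective_iff_surjective.1 hinj⟩
  · intro h
    refine ⟨(transSnd φ ψ X).comp (Ring.inverse (transFst φ ψ X)), ?_⟩
    rw [graphPlane_eq_iff, ContinuousLinearMap.comp_assoc]
    have : (Ring.inverse (transFst φ ψ X)).comp (transFst φ ψ X) = ContinuousLinearMap.id ℝ _ :=
      Ring.inverse_mul_cancel _ h
    rw [this, ContinuousLinearMap.comp_id]

theorem invFun_graphPlane (φ ψ : Splitting k n) (X : GrModel k n)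
    (h : graphPlane φ X ∈ range (graphPlane ψ)) :
    Function.invFun (graphPlane ψ) (graphPlane φ X) =
      (transSnd φ ψ X).comp (Ring.inverse (transFst φ ψ X)) := by
  have h1 := Function.invFun_eq h
  rw [graphPlane_eq_iff] at h1
  rw [h1, ContinuousLinearMap.comp_assoc]
  have : (transFst φ ψ X).comp (Ring.inverse (transFst φ ψ X)) = ContinuousLinearMap.id ℝ _ :=
    Ring.mul_inverse_cancel _ ((graphPlane_mem_range_iff φ ψ X).1 h)
  rw [this, ContinuousLinearMap.comp_id]

theorem isOpen_graphPlane (φ ψ : Splitting k n) :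
    IsOpen {X | graphPlane φ X ∈ range (graphPlane ψ)} := by
  simp only [graphPlane_mem_range_iff]
  exact Units.isOpen.preimage (contDiff_transFst φ ψ).continuous

theorem contDiffOn_graphPlane (φ ψ : Splitting k n) :
    ContDiffOn ℝ ∞ (fun X => Function.invFun (graphPlane ψ) (graphPlane φ X))
      {X | graphPlane φ X ∈ range (graphPlane ψ)} := by
  refine ContDiffOn.congr (f := fun X =>
    (transSnd φ ψ X).comp (Ring.inverse (transFst φ ψ X))) ?_
    (fun X hX => invFun_graphPlane φ ψ X hX)
  intro X hX
  obtain ⟨u, hu⟩ := (graphPlane_mem_range_iff φ ψ X).1 hX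
  have h1 : ContDiffAt ℝ ∞ (Ring.inverse : (EV k →L[ℝ] EV k) → _) (transFst φ ψ X) :=
    hu ▸ contDiffAt_ringInverse ℝ u
  exact ((contDiff_transSnd φ ψ).contDiffAt.clm_comp
    (h1.comp X (contDiff_transFst φ ψ).contDiffAt)).contDiffWithinAt

theorem graphFlat_mem_range_iff (φ ψ : Splitting k n) (p : GraffModel k n) :
    graphFlat φ p ∈ range (graphFlat ψ) ↔ graphPlane φ p.1 ∈ range (graphPlane ψ) := by
  constructor
  · rintro ⟨q, hq⟩
    exact ⟨q.1, ((graphFlat_eq_iff φ ψ p q).1 hq.symm).1.symm⟩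
  · rintro ⟨Y, hY⟩
    refine ⟨(Y, (ψ.symm (φ (0, p.2))).2 - Y (ψ.symm (φ (0, p.2))).1), Eq.symm ?_⟩
    rw [graphFlat_eq_iff]
    exact ⟨hY.symm, by simp⟩

theorem invFun_graphFlat (φ ψ : Splitting k n) (p : GraffModel k n)
    (h : graphFlat φ p ∈ range (graphFlat ψ)) :
    Function.invFun (graphFlat ψ) (graphFlat φ p) =
      (Function.invFun (graphPlane ψ) (graphPlane φ p.1), (ψ.symm (φ (0, p.2))).2 -
        Function.invFun (graphPlane ψ) (graphPlane φ p.1) (ψ.symm (φ (0, p.2))).1) := by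
  have h1 := (graphFlat_eq_iff _ _ _ _).1 (Function.invFun_eq h).symm
  set q := Function.invFun (graphFlat ψ) (graphFlat φ p) with hq
  have h2 : Function.invFun (graphPlane ψ) (graphPlane φ p.1) = q.1 := by
    rw [h1.1, Function.leftInverse_invFun (graphPlane_injective ψ)]
  rw [h2, h1.2, add_sub_cancel_left]

theorem isOpen_graphFlat (φ ψ : Splitting k n) :
    IsOpen {p | graphFlat φ p ∈ range (graphFlat ψ)} := by
  simp only [graphFlat_mem_range_iff]
  exact (isOpen_graphPlane φ ψ).preimage continuous_fst

theorem contDiffOn_graphFlat (φ ψ : Splitting k n) :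
    ContDiffOn ℝ ∞ (fun p => Function.invFun (graphFlat ψ) (graphFlat φ p))
      {p | graphFlat φ p ∈ range (graphFlat ψ)} := by
  refine ContDiffOn.congr ?_ (fun p hp => invFun_graphFlat φ ψ p hp)
  have h1 : ContDiffOn ℝ ∞
      (fun p : GraffModel k n => Function.invFun (graphPlane ψ) (graphPlane φ p.1))
      {p | graphFlat φ p ∈ range (graphFlat ψ)} :=
    (contDiffOn_graphPlane φ ψ).comp contDiff_fst.contDiffOn
      (fun p hp => (graphFlat_mem_range_iff φ ψ p).1 hp)
  have h2 : ContDiff ℝ ∞ (fun p : GraffModel k n => ψ.symm (φ ((0 : EV k), p.2))) :=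
    ψ.symm.contDiff.comp (φ.contDiff.comp (contDiff_const.prodMk contDiff_snd))
  exact h1.prodMk (h2.snd.contDiffOn.sub (h1.clm_apply h2.fst.contDiffOn))

/-- The standard atlas of `Gr(k,n)`: graph coordinates with respect to all splittings of `ℝⁿ`. -/
def grCore (k n : ℕ) : ChartedSpaceCore (GrModel k n) (Gr k n) :=
  coreOfParam graphPlane graphPlane_injective exists_graphPlane isOpen_graphPlane
    contDiffOn_graphPlane

/-- The standard atlas of `Graff(k,n)`: the flat `{φ (u, X u + y) | u ∈ ℝᵏ}` has the coordinates
`(X, y)` with respect to the splitting `φ` of `ℝⁿ`. -/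
def graffCore (k n : ℕ) : ChartedSpaceCore (GraffModel k n) (Graff k n) :=
  coreOfParam graphFlat graphFlat_injective exists_graphFlat isOpen_graphFlat
    contDiffOn_graphFlat

instance : TopologicalSpace (Gr k n) := (grCore k n).toTopologicalSpace

instance : ChartedSpace (GrModel k n) (Gr k n) := (grCore k n).toChartedSpace

instance : IsManifold 𝓘(ℝ, GrModel k n) ∞ (Gr k n) :=
  isManifold_coreOfParam graphPlane graphPlane_injective exists_graphPlane isOpen_graphPlane
    contDiffOn_graphPlane

instance : TopologicalSpace (Graff k n) := (graffCore k n).toTopologicalSpace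

instance : ChartedSpace (GraffModel k n) (Graff k n) := (graffCore k n).toChartedSpace

instance : IsManifold 𝓘(ℝ, GraffModel k n) ∞ (Graff k n) :=
  isManifold_coreOfParam graphFlat graphFlat_injective exists_graphFlat isOpen_graphFlat
    contDiffOn_graphFlat

/-! ## The fibers of the deaffine map -/

/-- The fiber `τ⁻¹(A)`: all translates of `A`. -/
def DeaffineFiber (A : Gr k n) : Type := {L : Graff k n // deaffine L = A}

/-- The element `A + b` of the fiber `τ⁻¹(A)`. -/
def fiberMk (A : Gr k n) (b : EV n) : DeaffineFiber A := ⟨translate A b, deaffine_translate A b⟩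

theorem fiberMk_eq_iff (A : Gr k n) (b c : EV n) :
    fiberMk A b = fiberMk A c ↔ b - c ∈ A.plane :=
  Subtype.ext_iff.trans ((translate_eq_iff A A b c).trans (by simp))

/-- The bijection `ℝⁿ / A → τ⁻¹(A)` that sends the class of `b` to `A + b`. -/
def fiberEquiv (A : Gr k n) : (EV n ⧸ A.plane) ≃ DeaffineFiber A :=
  Equiv.ofBijective
    (Quotient.lift (fiberMk A) fun b c h =>
      (fiberMk_eq_iff A b c).2 ((Submodule.quotientRel_def A.plane).1 h))
    (by
      constructor
      · rintro ⟨b⟩ ⟨c⟩ h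
        exact (Submodule.Quotient.eq A.plane).2 ((fiberMk_eq_iff A b c).1 h)
      · rintro ⟨L, rfl⟩
        obtain ⟨b, hb⟩ := exists_translate L
        exact ⟨Submodule.Quotient.mk b, Subtype.ext hb⟩)

theorem fiberEquiv_mk (A : Gr k n) (b : EV n) :
    fiberEquiv A (Submodule.Quotient.mk b) = fiberMk A b := rfl

/-- `τ⁻¹(A)` carries the vector space structure of `ℝⁿ / A`:
`(A + b) + (A + c) = A + (b + c)`. -/
instance (A : Gr k n) : AddCommGroup (DeaffineFiber A) := (fiberEquiv A).symm.addCommGroup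

/-- `τ⁻¹(A)` carries the vector space structure of `ℝⁿ / A`: `r (A + b) = A + r b`. -/
instance (A : Gr k n) : Module ℝ (DeaffineFiber A) := (fiberEquiv A).symm.module ℝ

theorem fiberMk_add (A : Gr k n) (b c : EV n) :
    fiberMk A (b + c) = fiberMk A b + fiberMk A c := by
  simp only [← fiberEquiv_mk, Equiv.add_def, Equiv.symm_symm, Equiv.symm_apply_apply]
  rfl

theorem fiberMk_smul (A : Gr k n) (r : ℝ) (b : EV n) :
    fiberMk A (r • b) = r • fiberMk A b := by
  simp only [← fiberEquiv_mk, Equiv.smul_def, Equiv.symm_symm, Equiv.symm_apply_apply]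
  rfl

/-! ## The three bundles and the maps between them

The fibers and the total spaces carry the topologies coming from `Graff(k,n)` and from
`Gr(k,n) × ℝⁿ`. -/

/-- The total space of the family of the fibers `τ⁻¹(A)` is `Graff(k,n)` itself. -/
def graffOfTotal (F : Type) (x : TotalSpace F (DeaffineFiber (k := k) (n := n))) : Graff k n :=
  x.snd.1

instance (A : Gr k n) : TopologicalSpace (DeaffineFiber A) :=
  TopologicalSpace.induced (fun L => L.1) inferInstance

instance (F : Type) : TopologicalSpace (TotalSpace F (DeaffineFiber (k := k) (n := n))) :=
  TopologicalSpace.induced (graffOfTotal F) inferInstance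

/-- The fiber of the tautological bundle over `A` is `A` itself. -/
def TautFiber (A : Gr k n) : Type := A.plane

instance (A : Gr k n) : AddCommGroup (TautFiber A) := inferInstanceAs (AddCommGroup A.plane)

instance (A : Gr k n) : Module ℝ (TautFiber A) := inferInstanceAs (Module ℝ A.plane)

instance (A : Gr k n) : TopologicalSpace (TautFiber A) :=
  inferInstanceAs (TopologicalSpace A.plane)

/-- The total space `{(A, v) | v ∈ A}` of the tautological bundle inside `Gr(k,n) × ℝⁿ`. -/
instance (F : Type) : TopologicalSpace (TotalSpace F (TautFiber (k := k) (n := n))) :=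
  TopologicalSpace.induced
    (fun x => ((x.proj, (show x.proj.plane from x.snd : EV n)) : Gr k n × EV n)) inferInstance

/-- The inclusion of the fiber of the tautological bundle into the fiber of the trivial bundle. -/
def tautIncl (A : Gr k n) : TautFiber A →ₗ[ℝ] Bundle.Trivial (Gr k n) (EV n) A :=
  A.plane.subtype

/-- The map `b ↦ A + b` from the fiber of the trivial bundle to `τ⁻¹(A)`. -/
def translateFiber (A : Gr k n) : Bundle.Trivial (Gr k n) (EV n) A →ₗ[ℝ] DeaffineFiber A where
  toFun := fiberMk A
  map_add' := fiberMk_add A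
  map_smul' := fiberMk_smul A

section Bundles

variable {EB HB B : Type} [NormedAddCommGroup EB] [NormedSpace ℝ EB] [TopologicalSpace HB]
  (IB : ModelWithCorners ℝ EB HB) [TopologicalSpace B] [ChartedSpace HB B]
  (F₁ F₂ F₃ : Type) [NormedAddCommGroup F₁] [NormedSpace ℝ F₁] [NormedAddCommGroup F₂]
  [NormedSpace ℝ F₂] [NormedAddCommGroup F₃] [NormedSpace ℝ F₃]
  {E₁ E₂ E₃ : B → Type}
  [∀ b, AddCommGroup (E₁ b)] [∀ b, Module ℝ (E₁ b)] [∀ b, TopologicalSpace (E₁ b)]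
  [∀ b, AddCommGroup (E₂ b)] [∀ b, Module ℝ (E₂ b)] [∀ b, TopologicalSpace (E₂ b)]
  [∀ b, AddCommGroup (E₃ b)] [∀ b, Module ℝ (E₃ b)] [∀ b, TopologicalSpace (E₃ b)]
  [TopologicalSpace (TotalSpace F₁ E₁)] [FiberBundle F₁ E₁]
  [TopologicalSpace (TotalSpace F₂ E₂)] [FiberBundle F₂ E₂]
  [TopologicalSpace (TotalSpace F₃ E₃)] [FiberBundle F₃ E₃]

/-- A family of linear maps between the fibers of two bundles over the same base is a smooth
bundle map if the induced map of total spaces is smooth. -/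
def IsSmoothBundleMap (f : ∀ b, E₁ b →ₗ[ℝ] E₂ b) : Prop :=
  ContMDiff (IB.prod 𝓘(ℝ, F₁)) (IB.prod 𝓘(ℝ, F₂)) ∞
    (fun x : TotalSpace F₁ E₁ => (⟨x.proj, f x.proj x.snd⟩ : TotalSpace F₂ E₂))

/-- `0 → E₁ → E₂ → E₃ → 0` is a short exact sequence of smooth vector bundles: both maps are smooth
bundle maps, and the sequence is exact on every fiber. -/
structure IsShortExact (f : ∀ b, E₁ b →ₗ[ℝ] E₂ b) (g : ∀ b, E₂ b →ₗ[ℝ] E₃ b) : Prop where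
  smooth_left : IsSmoothBundleMap IB F₁ F₂ f
  smooth_right : IsSmoothBundleMap IB F₂ F₃ g
  injective : ∀ b, Function.Injective (f b)
  exact : ∀ b, Function.Exact (f b) (g b)
  surjective : ∀ b, Function.Surjective (g b)

end Bundles

end AffineGrassmannian

end

open AffineGrassmannian

/-!
For a splitting `φ` of `ℝⁿ`, the planes that are graphs in the coordinates `φ` form a chart domain
of `Gr(k,n)`, with coordinate `X`. Over it, the flat `A + b` is determined by `A` and by its height
`y = b₂ - X b₁`, where `φ (b₁, b₂) = b`, and a vector `v ∈ A` is determined by `A` and by the first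
component of `φ⁻¹ v`. These are the local trivializations of `Graff(k,n)` and of the tautological
bundle.

Everything follows from two families of linear maps that are affine, hence smooth, in `X`: the
height `heightCLM φ X : ℝⁿ → ℝⁿ⁻ᵏ`, with kernel the graph of `X`, and the parametrization
`graphCLM φ X : ℝᵏ → ℝⁿ` of that graph. The coordinate changes of `Graff(k,n)` are restrictions of
heights, and those of the tautological bundle are components of graph parametrizations; in local
trivializations the map `(A, b) ↦ A + b` is the height and the inclusion `S → Gr(k,n) × ℝⁿ` is the
graph parametrization. Finally, the graph coordinates `(X, y)` of the manifold `Graff(k,n)` are the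
coordinate `X` of the base together with the fiber coordinate `y`, so the smooth structure of the
total space is that of `Graff(k,n)`.
-/

noncomputable section

namespace AffineGrassmannian

variable {k n : ℕ}

/-! ### Graph coordinates -/

/-- The graph coordinate of a plane with respect to the splitting `φ`. It is meaningful only on
`range (graphPlane φ)`. -/
def grCoord (φ : Splitting k n) : Gr k n → GrModel k n := Function.invFun (graphPlane φ)

/-- The graph coordinates of a flat with respect to the splitting `φ`. They are meaningful only on
`range (graphFlat φ)`. -/
def graffCoord (φ : Splitting k n) : Graff k n → GraffModel k n := Function.invFun (graphFlat φ)

theorem grCoord_graphPlane (φ : Splitting k n) (X : GrModel k n) :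
    grCoord φ (graphPlane φ X) = X :=
  Function.leftInverse_invFun (graphPlane_injective φ) X

theorem graphPlane_grCoord {φ : Splitting k n} {A : Gr k n} (hA : A ∈ range (graphPlane φ)) :
    graphPlane φ (grCoord φ A) = A :=
  Function.invFun_eq hA

theorem graffCoord_graphFlat (φ : Splitting k n) (p : GraffModel k n) :
    graffCoord φ (graphFlat φ p) = p :=
  Function.leftInverse_invFun (graphFlat_injective φ) p

theorem deaffine_graphFlat (φ : Splitting k n) (p : GraffModel k n) :
    deaffine (graphFlat φ p) = graphPlane φ p.1 :=
  deaffine_translate _ _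

/-- Graph coordinates as a chart of `Gr(k,n)`. -/
def grChart (φ : Splitting k n) : OpenPartialHomeomorph (Gr k n) (GrModel k n) :=
  (grCore k n).openPartialHomeomorph (chartOfParam (graphPlane φ) (graphPlane_injective φ))
    (mem_range_self φ)

theorem grChart_mem_maximalAtlas (φ : Splitting k n) :
    grChart φ ∈ IsManifold.maximalAtlas 𝓘(ℝ, GrModel k n) ∞ (Gr k n) :=
  IsManifold.subset_maximalAtlas (mem_iUnion₂.2 ⟨_, mem_range_self φ, rfl⟩)

/-- Graph coordinates as a chart of `Graff(k,n)`. -/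
def graffChart (φ : Splitting k n) : OpenPartialHomeomorph (Graff k n) (GraffModel k n) :=
  (graffCore k n).openPartialHomeomorph (chartOfParam (graphFlat φ) (graphFlat_injective φ))
    (mem_range_self φ)

theorem graffChart_mem_maximalAtlas (φ : Splitting k n) :
    graffChart φ ∈ IsManifold.maximalAtlas 𝓘(ℝ, GraffModel k n) ∞ (Graff k n) :=
  IsManifold.subset_maximalAtlas (mem_iUnion₂.2 ⟨_, mem_range_self φ, rfl⟩)

theorem isOpen_range_graphPlane (φ : Splitting k n) : IsOpen (range (graphPlane φ)) :=
  (grChart φ).open_source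

theorem isOpen_range_graphFlat (φ : Splitting k n) : IsOpen (range (graphFlat φ)) :=
  (graffChart φ).open_source

theorem contMDiffOn_grCoord (φ : Splitting k n) :
    ContMDiffOn 𝓘(ℝ, GrModel k n) 𝓘(ℝ, GrModel k n) ∞ (grCoord φ) (range (graphPlane φ)) :=
  contMDiffOn_of_mem_maximalAtlas (grChart_mem_maximalAtlas φ)

theorem contMDiff_graphPlane (φ : Splitting k n) :
    ContMDiff 𝓘(ℝ, GrModel k n) 𝓘(ℝ, GrModel k n) ∞ (graphPlane φ) :=
  contMDiffOn_univ.1 (contMDiffOn_symm_of_mem_maximalAtlas (grChart_mem_maximalAtlas φ))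

theorem contMDiffOn_graffCoord (φ : Splitting k n) :
    ContMDiffOn 𝓘(ℝ, GraffModel k n) 𝓘(ℝ, GraffModel k n) ∞ (graffCoord φ)
      (range (graphFlat φ)) :=
  contMDiffOn_of_mem_maximalAtlas (graffChart_mem_maximalAtlas φ)

theorem contMDiff_graphFlat (φ : Splitting k n) :
    ContMDiff 𝓘(ℝ, GraffModel k n) 𝓘(ℝ, GraffModel k n) ∞ (graphFlat φ) :=
  contMDiffOn_univ.1 (contMDiffOn_symm_of_mem_maximalAtlas (graffChart_mem_maximalAtlas φ))

theorem contMDiff_deaffine :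
    ContMDiff 𝓘(ℝ, GraffModel k n) 𝓘(ℝ, GrModel k n) ∞ (deaffine (k := k) (n := n)) := by
  intro L
  obtain ⟨φ, hL⟩ := exists_graphFlat L
  have hU := (isOpen_range_graphFlat φ).mem_nhds hL
  have h : ContMDiffAt 𝓘(ℝ, GraffModel k n) 𝓘(ℝ, GrModel k n) ∞
      (fun L => graphPlane φ (graffCoord φ L).1) L :=
    (contMDiff_graphPlane φ).contMDiffAt.comp L
      (contDiff_fst.contMDiff.contMDiffAt.comp L ((contMDiffOn_graffCoord φ).contMDiffAt hU))
  refine h.congr_of_eventuallyEq ?_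
  filter_upwards [hU]
  rintro _ ⟨p, rfl⟩
  rw [graffCoord_graphFlat, deaffine_graphFlat]

/-! ### Heights and graph parametrizations -/

/-- The height of a vector above the graph of `X` in the coordinates `φ`:
`φ (u, w) ↦ w - X u`. -/
def heightCLM (φ : Splitting k n) (X : GrModel k n) : EV n →L[ℝ] EV (n - k) :=
  (ContinuousLinearMap.snd ℝ _ _ - X.comp (ContinuousLinearMap.fst ℝ _ _)).comp
    φ.symm.toContinuousLinearMap

/-- The parametrization `u ↦ φ (u, X u)` of the graph of `X` in the coordinates `φ`. -/
def graphCLM (φ : Splitting k n) (X : GrModel k n) : EV k →L[ℝ] EV n :=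
  φ.toContinuousLinearMap.comp
    (ContinuousLinearMap.inl ℝ _ _ + (ContinuousLinearMap.inr ℝ _ _).comp X)

theorem heightCLM_apply (φ : Splitting k n) (X : GrModel k n) (b : EV n) :
    heightCLM φ X b = (φ.symm b).2 - X (φ.symm b).1 := by
  simp [heightCLM]

theorem graphCLM_apply (φ : Splitting k n) (X : GrModel k n) (u : EV k) :
    graphCLM φ X u = φ (u, X u) := by
  have h : (u, X u) = (u, 0) + (0, X u) := by simp
  rw [h, map_add]
  simp [graphCLM]

theorem contDiff_heightCLM (φ : Splitting k n) : ContDiff ℝ ∞ (heightCLM φ) :=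
  (contDiff_const.sub (contDiff_id.clm_comp contDiff_const)).clm_comp contDiff_const

theorem contDiff_graphCLM (φ : Splitting k n) : ContDiff ℝ ∞ (graphCLM φ) :=
  contDiff_const.clm_comp (contDiff_const.add (contDiff_const.clm_comp contDiff_id))

theorem contMDiffOn_heightCLM (φ : Splitting k n) :
    ContMDiffOn 𝓘(ℝ, GrModel k n) 𝓘(ℝ, EV n →L[ℝ] EV (n - k)) ∞
      (fun A => heightCLM φ (grCoord φ A)) (range (graphPlane φ)) :=
  (contDiff_heightCLM φ).contMDiff.comp_contMDiffOn (contMDiffOn_grCoord φ)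

theorem contMDiffOn_graphCLM (φ : Splitting k n) :
    ContMDiffOn 𝓘(ℝ, GrModel k n) 𝓘(ℝ, EV k →L[ℝ] EV n) ∞
      (fun A => graphCLM φ (grCoord φ A)) (range (graphPlane φ)) :=
  (contDiff_graphCLM φ).contMDiff.comp_contMDiffOn (contMDiffOn_grCoord φ)

theorem graphCLM_mem (φ : Splitting k n) (X : GrModel k n) (u : EV k) :
    graphCLM φ X u ∈ (graphPlane φ X).plane := by
  rw [mem_graphPlane, graphCLM_apply]
  simp

theorem graphCLM_fst (φ : Splitting k n) {A : Gr k n} (hA : A ∈ range (graphPlane φ))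
    {v : EV n} (hv : v ∈ A.plane) : graphCLM φ (grCoord φ A) (φ.symm v).1 = v := by
  obtain ⟨X, rfl⟩ := hA
  rw [mem_graphPlane] at hv
  rw [grCoord_graphPlane, graphCLM_apply, ← hv]
  simp

theorem translate_graphPlane (φ : Splitting k n) (X : GrModel k n) (b : EV n) :
    translate (graphPlane φ X) b = graphFlat φ (X, heightCLM φ X b) := by
  rw [graphFlat, translate_eq_iff, mem_graphPlane, heightCLM_apply]
  simp

theorem graffCoord_translate {φ : Splitting k n} {A : Gr k n} (hA : A ∈ range (graphPlane φ))
    (b : EV n) :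
    graffCoord φ (translate A b) = (grCoord φ A, heightCLM φ (grCoord φ A) b) := by
  obtain ⟨X, rfl⟩ := hA
  rw [translate_graphPlane, graffCoord_graphFlat, grCoord_graphPlane]

theorem translate_eq_graphFlat {φ : Splitting k n} {A : Gr k n} (hA : A ∈ range (graphPlane φ))
    (y : EV (n - k)) : translate A (φ (0, y)) = graphFlat φ (grCoord φ A, y) := by
  rw [graphFlat, graphPlane_grCoord hA]

theorem mem_range_graphFlat_iff (φ : Splitting k n) (L : Graff k n) :
    L ∈ range (graphFlat φ) ↔ deaffine L ∈ range (graphPlane φ) := by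
  constructor
  · rintro ⟨p, rfl⟩
    exact ⟨p.1, (deaffine_graphFlat φ p).symm⟩
  · rintro ⟨X, hX⟩
    obtain ⟨b, hb⟩ := exists_translate L
    exact ⟨_, by rw [← hb, ← hX, translate_graphPlane]⟩

theorem fiberMk_surjective (A : Gr k n) : Function.Surjective (fiberMk A) := by
  rintro ⟨L, rfl⟩
  obtain ⟨b, hb⟩ := exists_translate L
  exact ⟨b, Subtype.ext hb⟩

/-! ### The bundle of translates -/

theorem deaffine_graffOfTotal {F : Type}
    (x : TotalSpace F (DeaffineFiber (k := k) (n := n))) :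
    deaffine (graffOfTotal F x) = x.proj :=
  x.snd.2

theorem continuous_graffOfTotal (F : Type) :
    Continuous (graffOfTotal (k := k) (n := n) F) :=
  continuous_induced_dom

theorem continuous_proj_deaffine (F : Type) :
    Continuous (π F (DeaffineFiber (k := k) (n := n))) :=
  (contMDiff_deaffine.continuous.comp (continuous_graffOfTotal F)).congr deaffine_graffOfTotal

/-- The local trivialization of `Graff(k,n)` over the planes that are graphs in the coordinates
`φ`, by the height of a flat. -/
def graffTriv (φ : Splitting k n) :
    Trivialization (EV (n - k)) (π (EV (n - k)) (DeaffineFiber (k := k) (n := n))) where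
  toFun x := (x.proj, (graffCoord φ (graffOfTotal _ x)).2)
  invFun p := ⟨p.1, fiberMk p.1 (φ (0, p.2))⟩
  source := π _ _ ⁻¹' range (graphPlane φ)
  target := range (graphPlane φ) ×ˢ univ
  map_source' _ hx := ⟨hx, mem_univ _⟩
  map_target' _ hp := hp.1
  left_inv' := by
    rintro ⟨A, L⟩ hA
    obtain ⟨b, rfl⟩ := fiberMk_surjective A L
    refine congrArg (TotalSpace.mk A) (Subtype.ext ?_)
    change translate A (φ (0, (graffCoord φ (translate A b)).2)) = translate A b
    rw [translate_eq_graphFlat hA, graffCoord_translate hA]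
    obtain ⟨X, rfl⟩ := hA
    rw [grCoord_graphPlane, translate_graphPlane]
  right_inv' := by
    rintro ⟨A, y⟩ hp
    refine Prod.ext rfl ?_
    change (graffCoord φ (translate A (φ (0, y)))).2 = y
    rw [translate_eq_graphFlat hp.1, graffCoord_graphFlat]
  open_source := (isOpen_range_graphPlane φ).preimage (continuous_proj_deaffine _)
  open_target := (isOpen_range_graphPlane φ).prod isOpen_univ
  continuousOn_toFun :=
    (continuous_proj_deaffine _).continuousOn.prodMk
      (continuous_snd.comp_continuousOn ((contMDiffOn_graffCoord φ).continuousOn.comp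
        (continuous_graffOfTotal _).continuousOn fun x hx =>
          (mem_range_graphFlat_iff φ _).2 ((deaffine_graffOfTotal x).symm ▸ hx)))
  continuousOn_invFun := by
    refine (Topology.IsInducing.induced (graffOfTotal (EV (n - k)))).continuousOn_iff.2 ?_
    have h : ContinuousOn (fun p : Gr k n × EV (n - k) => graphFlat φ (grCoord φ p.1, p.2))
        (range (graphPlane φ) ×ˢ univ) :=
      (contMDiff_graphFlat φ).continuous.comp_continuousOn
        (((contMDiffOn_grCoord φ).continuousOn.comp continuous_fst.continuousOn
          fun p hp => hp.1).prodMk continuous_snd.continuousOn)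
    exact h.congr fun p hp => translate_eq_graphFlat hp.1 p.2
  baseSet := range (graphPlane φ)
  open_baseSet := isOpen_range_graphPlane φ
  source_eq := rfl
  target_eq := rfl
  proj_toFun _ _ := rfl

theorem graffTriv_fiberMk {φ : Splitting k n} {A : Gr k n} (hA : A ∈ range (graphPlane φ))
    (b : EV n) : (graffTriv φ ⟨A, fiberMk A b⟩).2 = heightCLM φ (grCoord φ A) b :=
  congrArg Prod.snd (graffCoord_translate hA b)

instance graffTriv_isLinear (φ : Splitting k n) : (graffTriv φ).IsLinear ℝ where
  linear A hA := by
    constructor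
    · intro L L'
      obtain ⟨b, rfl⟩ := fiberMk_surjective A L
      obtain ⟨c, rfl⟩ := fiberMk_surjective A L'
      rw [← fiberMk_add, graffTriv_fiberMk hA, graffTriv_fiberMk hA, graffTriv_fiberMk hA, map_add]
    · intro r L
      obtain ⟨b, rfl⟩ := fiberMk_surjective A L
      rw [← fiberMk_smul, graffTriv_fiberMk hA, graffTriv_fiberMk hA, map_smul]

theorem contMDiffOn_coordChangeL_graffTriv (φ ψ : Splitting k n) :
    ContMDiffOn 𝓘(ℝ, GrModel k n) 𝓘(ℝ, EV (n - k) →L[ℝ] EV (n - k)) ∞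
      (fun A => ((graffTriv φ).coordChangeL ℝ (graffTriv ψ) A : EV (n - k) →L[ℝ] EV (n - k)))
      (range (graphPlane φ) ∩ range (graphPlane ψ)) := by
  have h : ContMDiffOn 𝓘(ℝ, GrModel k n) 𝓘(ℝ, EV (n - k) →L[ℝ] EV (n - k)) ∞
      (fun A => (heightCLM ψ (grCoord ψ A)).comp
        (φ.toContinuousLinearMap.comp (ContinuousLinearMap.inr ℝ _ _)))
      (range (graphPlane φ) ∩ range (graphPlane ψ)) :=
    ((contMDiffOn_heightCLM ψ).mono inter_subset_right).clm_comp contMDiffOn_const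
  refine h.congr fun A hA => ?_
  ext1 y
  exact ((graffTriv φ).coordChangeL_apply' (graffTriv ψ) hA y).trans (graffTriv_fiberMk hA.2 _)

instance graffFiberBundle :
    FiberBundle (EV (n - k)) (DeaffineFiber (k := k) (n := n)) where
  totalSpaceMk_isInducing' A := by
    have h : Topology.IsInducing (fun L : DeaffineFiber A => L.1) := ⟨rfl⟩
    exact (Topology.IsInducing.induced (graffOfTotal (EV (n - k)))).of_comp_iff.1 h
  trivializationAtlas' := range graffTriv
  trivializationAt' A := graffTriv (exists_graphPlane A).choose
  mem_baseSet_trivializationAt' A := (exists_graphPlane A).choose_spec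
  trivialization_mem_atlas' _ := mem_range_self _

instance (φ : Splitting k n) : MemTrivializationAtlas (graffTriv φ) := ⟨mem_range_self φ⟩

instance graffVectorBundle :
    VectorBundle ℝ (EV (n - k)) (DeaffineFiber (k := k) (n := n)) where
  trivialization_linear' := by
    rintro _ ⟨φ, rfl⟩
    infer_instance
  continuousOn_coordChange' := by
    rintro _ _ ⟨φ, rfl⟩ ⟨ψ, rfl⟩
    exact (contMDiffOn_coordChangeL_graffTriv φ ψ).continuousOn

instance graffContMDiffVectorBundle :
    ContMDiffVectorBundle ∞ (EV (n - k)) (DeaffineFiber (k := k) (n := n))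
      𝓘(ℝ, GrModel k n) where
  contMDiffOn_coordChangeL := by
    rintro _ _ ⟨φ, rfl⟩ ⟨ψ, rfl⟩
    exact contMDiffOn_coordChangeL_graffTriv φ ψ

theorem contMDiff_graffOfTotal :
    ContMDiff (𝓘(ℝ, GrModel k n).prod 𝓘(ℝ, EV (n - k))) 𝓘(ℝ, GraffModel k n) ∞
      (graffOfTotal (k := k) (n := n) (EV (n - k))) := by
  intro x
  obtain ⟨φ, hφ⟩ := exists_graphPlane x.proj
  have hx : x ∈ (graffTriv φ).source := hφ
  have hX := ((contMDiffOn_grCoord φ).contMDiffAt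
    ((isOpen_range_graphPlane φ).mem_nhds hφ)).comp x
      (contMDiffAt_proj (DeaffineFiber (k := k) (n := n)) (F := EV (n - k)))
  have hy := ((graffTriv φ).contMDiffAt_iff (IB := 𝓘(ℝ, GrModel k n)) (n := ∞) hx).1
    contMDiffAt_id |>.2
  have h := (contMDiff_graphFlat φ).contMDiffAt.comp x (hX.prodMk_space hy)
  refine h.congr_of_eventuallyEq ?_
  filter_upwards [(graffTriv φ).open_source.mem_nhds hx]
  rintro ⟨A, L⟩ hA
  obtain ⟨b, rfl⟩ := fiberMk_surjective A L
  change translate A b = graphFlat φ (grCoord φ A, (graffTriv φ ⟨A, fiberMk A b⟩).2)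
  rw [graffTriv_fiberMk hA]
  obtain ⟨X, rfl⟩ := hA
  rw [grCoord_graphPlane, translate_graphPlane]

/-- A flat, as a point of the total space of the bundle of translates. -/
def totalOfGraff (L : Graff k n) :
    TotalSpace (EV (n - k)) (DeaffineFiber (k := k) (n := n)) :=
  ⟨deaffine L, L, rfl⟩

theorem contMDiff_totalOfGraff :
    ContMDiff 𝓘(ℝ, GraffModel k n) (𝓘(ℝ, GrModel k n).prod 𝓘(ℝ, EV (n - k))) ∞
      (totalOfGraff (k := k) (n := n)) := by
  intro L
  obtain ⟨φ, hφ⟩ := exists_graphFlat L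
  have hL : totalOfGraff L ∈ (graffTriv φ).source := (mem_range_graphFlat_iff φ L).1 hφ
  have hy : ContMDiffAt 𝓘(ℝ, GraffModel k n) 𝓘(ℝ, EV (n - k)) ∞
      (fun L => (graffCoord φ L).2) L :=
    contDiff_snd.contMDiff.contMDiffAt.comp L ((contMDiffOn_graffCoord φ).contMDiffAt
      ((isOpen_range_graphFlat φ).mem_nhds hφ))
  exact ((graffTriv φ).contMDiffAt_iff hL).2 ⟨contMDiff_deaffine L, hy⟩

/-- The total space of the bundle of translates is the manifold `Graff(k,n)`. -/
def graffDiffeomorph :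
    Diffeomorph (𝓘(ℝ, GrModel k n).prod 𝓘(ℝ, EV (n - k))) 𝓘(ℝ, GraffModel k n)
      (TotalSpace (EV (n - k)) (DeaffineFiber (k := k) (n := n))) (Graff k n) ∞ where
  toFun := graffOfTotal _
  invFun := totalOfGraff
  left_inv := by rintro ⟨_, L, rfl⟩; rfl
  right_inv _ := rfl
  contMDiff_toFun := contMDiff_graffOfTotal
  contMDiff_invFun := contMDiff_totalOfGraff

/-! ### The tautological bundle -/

/-- The vector `v` of the point `(A, v)` of the tautological bundle. -/
def tautVec {F : Type} (x : TotalSpace F (TautFiber (k := k) (n := n))) : EV n :=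
  (show x.proj.plane from x.snd : EV n)

theorem isInducing_proj_tautVec (F : Type) :
    Topology.IsInducing
      (fun x : TotalSpace F (TautFiber (k := k) (n := n)) => (x.proj, tautVec x)) :=
  ⟨rfl⟩

theorem tautVec_mem {F : Type} (x : TotalSpace F (TautFiber (k := k) (n := n))) :
    tautVec x ∈ x.proj.plane :=
  Subtype.prop (show x.proj.plane from x.snd)

theorem taut_ext {F : Type} {x y : TotalSpace F (TautFiber (k := k) (n := n))}
    (h : x.proj = y.proj) (hv : tautVec x = tautVec y) : x = y := by
  obtain ⟨A, v⟩ := x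
  obtain ⟨B, w⟩ := y
  obtain rfl : A = B := h
  exact congrArg (TotalSpace.mk A) (Subtype.ext hv)

/-- The point `(A, φ (u, X u))` of the tautological bundle, where `A` is the graph of `X` in the
coordinates `φ`. -/
def tautPoint (φ : Splitting k n) (X : GrModel k n) (u : EV k) :
    TotalSpace (EV k) (TautFiber (k := k) (n := n)) :=
  ⟨graphPlane φ X, (⟨graphCLM φ X u, graphCLM_mem φ X u⟩ : (graphPlane φ X).plane)⟩

/-- The local trivialization of the tautological bundle over the planes that are graphs in the
coordinates `φ`: a vector of such a plane is sent to its first component. -/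
def tautTriv (φ : Splitting k n) :
    Trivialization (EV k) (π (EV k) (TautFiber (k := k) (n := n))) where
  toFun x := (x.proj, (φ.symm (tautVec x)).1)
  invFun p := tautPoint φ (grCoord φ p.1) p.2
  source := π _ _ ⁻¹' range (graphPlane φ)
  target := range (graphPlane φ) ×ˢ univ
  map_source' _ hx := ⟨hx, mem_univ _⟩
  map_target' p _ := mem_range_self (grCoord φ p.1)
  left_inv' x hx := taut_ext (graphPlane_grCoord hx) (graphCLM_fst φ hx (tautVec_mem x))
  right_inv' := by
    rintro ⟨A, u⟩ hp
    refine Prod.ext (graphPlane_grCoord hp.1) ?_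
    change (φ.symm (graphCLM φ (grCoord φ A) u)).1 = u
    rw [graphCLM_apply]
    simp
  open_source := (isOpen_range_graphPlane φ).preimage
    (continuous_fst.comp (isInducing_proj_tautVec _).continuous)
  open_target := (isOpen_range_graphPlane φ).prod isOpen_univ
  continuousOn_toFun := by
    have h := (isInducing_proj_tautVec (k := k) (n := n) (EV k)).continuous
    exact ((continuous_fst.comp h).prodMk
      (continuous_fst.comp (φ.symm.continuous.comp (continuous_snd.comp h)))).continuousOn
  continuousOn_invFun := by
    refine (isInducing_proj_tautVec (EV k)).continuousOn_iff.2 ?_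
    have h : ContinuousOn
        (fun p : Gr k n × EV k => (p.1, graphCLM φ (grCoord φ p.1) p.2))
        (range (graphPlane φ) ×ˢ univ) :=
      continuous_fst.continuousOn.prodMk
        (((contMDiffOn_graphCLM φ).continuousOn.comp continuous_fst.continuousOn
          fun p hp => hp.1).clm_apply continuous_snd.continuousOn)
    exact h.congr fun p hp => Prod.ext (graphPlane_grCoord hp.1) rfl
  baseSet := range (graphPlane φ)
  open_baseSet := isOpen_range_graphPlane φ
  source_eq := rfl
  target_eq := rfl
  proj_toFun _ _ := rfl

instance tautTriv_isLinear (φ : Splitting k n) : (tautTriv φ).IsLinear ℝ where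
  linear A _ :=
    ((LinearMap.fst ℝ _ _).comp (φ.symm.toLinearEquiv.toLinearMap.comp A.plane.subtype)).isLinear

theorem contMDiffOn_coordChangeL_tautTriv (φ ψ : Splitting k n) :
    ContMDiffOn 𝓘(ℝ, GrModel k n) 𝓘(ℝ, EV k →L[ℝ] EV k) ∞
      (fun A => ((tautTriv φ).coordChangeL ℝ (tautTriv ψ) A : EV k →L[ℝ] EV k))
      (range (graphPlane φ) ∩ range (graphPlane ψ)) := by
  have h : ContMDiffOn 𝓘(ℝ, GrModel k n) 𝓘(ℝ, EV k →L[ℝ] EV k) ∞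
      (fun A => ((ContinuousLinearMap.fst ℝ _ _).comp ψ.symm.toContinuousLinearMap).comp
        (graphCLM φ (grCoord φ A)))
      (range (graphPlane φ) ∩ range (graphPlane ψ)) :=
    contMDiffOn_const.clm_comp ((contMDiffOn_graphCLM φ).mono inter_subset_left)
  refine h.congr fun A hA => ?_
  ext1 u
  exact (tautTriv φ).coordChangeL_apply' (tautTriv ψ) hA u

instance tautFiberBundle : FiberBundle (EV k) (TautFiber (k := k) (n := n)) where
  totalSpaceMk_isInducing' A := by
    refine (isInducing_proj_tautVec (EV k)).of_comp_iff.1 ?_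
    have h : Topology.IsInducing (Subtype.val : A.plane → EV n) := .subtypeVal
    exact (isInducing_prodMkRight A).comp h
  trivializationAtlas' := range tautTriv
  trivializationAt' A := tautTriv (exists_graphPlane A).choose
  mem_baseSet_trivializationAt' A := (exists_graphPlane A).choose_spec
  trivialization_mem_atlas' _ := mem_range_self _

instance (φ : Splitting k n) : MemTrivializationAtlas (tautTriv φ) := ⟨mem_range_self φ⟩

instance tautVectorBundle : VectorBundle ℝ (EV k) (TautFiber (k := k) (n := n)) where
  trivialization_linear' := by
    rintro _ ⟨φ, rfl⟩
    infer_instance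
  continuousOn_coordChange' := by
    rintro _ _ ⟨φ, rfl⟩ ⟨ψ, rfl⟩
    exact (contMDiffOn_coordChangeL_tautTriv φ ψ).continuousOn

instance tautContMDiffVectorBundle :
    ContMDiffVectorBundle ∞ (EV k) (TautFiber (k := k) (n := n)) 𝓘(ℝ, GrModel k n) where
  contMDiffOn_coordChangeL := by
    rintro _ _ ⟨φ, rfl⟩ ⟨ψ, rfl⟩
    exact contMDiffOn_coordChangeL_tautTriv φ ψ

/-! ### The short exact sequence -/

theorem isSmoothBundleMap_tautIncl :
    IsSmoothBundleMap 𝓘(ℝ, GrModel k n) (EV k) (EV n) (tautIncl (k := k) (n := n)) := by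
  intro x
  refine contMDiffAt_totalSpace.2 ⟨contMDiffAt_proj _, ?_⟩
  change ContMDiffAt _ _ _ tautVec x
  obtain ⟨φ, hφ⟩ := exists_graphPlane x.proj
  have hx : x ∈ (tautTriv φ).source := hφ
  have hX := ((contMDiffOn_graphCLM φ).contMDiffAt
    ((isOpen_range_graphPlane φ).mem_nhds hφ)).comp x
      (contMDiffAt_proj (TautFiber (k := k) (n := n)) (F := EV k))
  have hu := ((tautTriv φ).contMDiffAt_iff (IB := 𝓘(ℝ, GrModel k n)) (n := ∞) hx).1
    contMDiffAt_id |>.2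
  refine (hX.clm_apply hu).congr_of_eventuallyEq ?_
  filter_upwards [(tautTriv φ).open_source.mem_nhds hx] with y hy
  exact (graphCLM_fst φ hy (tautVec_mem y)).symm

theorem isSmoothBundleMap_translateFiber :
    IsSmoothBundleMap 𝓘(ℝ, GrModel k n) (EV n) (EV (n - k))
      (translateFiber (k := k) (n := n)) := by
  intro x
  obtain ⟨φ, hφ⟩ := exists_graphPlane x.proj
  refine ((graffTriv φ).contMDiffAt_iff hφ).2 ⟨contMDiffAt_proj _, ?_⟩
  have hX := ((contMDiffOn_heightCLM φ).contMDiffAt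
    ((isOpen_range_graphPlane φ).mem_nhds hφ)).comp x
      (contMDiffAt_proj (Bundle.Trivial (Gr k n) (EV n)) (F := EV n))
  have hb := (contMDiffAt_totalSpace (IB := 𝓘(ℝ, GrModel k n)) (n := ∞)
    (E := Bundle.Trivial (Gr k n) (EV n)) (x₀ := x)).1 contMDiffAt_id |>.2
  refine (hX.clm_apply hb).congr_of_eventuallyEq ?_
  filter_upwards [((isOpen_range_graphPlane φ).preimage
    (FiberBundle.continuous_proj (EV n) (Bundle.Trivial (Gr k n) (EV n)))).mem_nhds hφ] with y hy
  exact graffTriv_fiberMk hy y.snd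

theorem fiberMk_eq_zero_iff (A : Gr k n) (b : EV n) : fiberMk A b = 0 ↔ b ∈ A.plane := by
  have h : fiberMk A 0 = 0 := (translateFiber A).map_zero
  rw [← h, fiberMk_eq_iff, sub_zero]

theorem isShortExact_taut :
    IsShortExact 𝓘(ℝ, GrModel k n) (EV k) (EV n) (EV (n - k))
      (tautIncl (k := k) (n := n)) (translateFiber (k := k) (n := n)) where
  smooth_left := isSmoothBundleMap_tautIncl
  smooth_right := isSmoothBundleMap_translateFiber
  injective A := A.plane.injective_subtype
  exact A b := by
    refine (fiberMk_eq_zero_iff A b).trans ?_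
    exact ⟨fun h => ⟨⟨b, h⟩, rfl⟩, by rintro ⟨v, rfl⟩; exact v.2⟩
  surjective := fiberMk_surjective

end AffineGrassmannian

end

theorem theorem7p1 (k n : ℕ) (hk : 0 < k) (hkn : k < n) :
    -- `Graff(k,n)` with the projection `τ` is a smooth vector bundle of rank `n - k`
    ∃ (_ : FiberBundle (EV (n - k)) (DeaffineFiber (k := k) (n := n)))
      (_ : VectorBundle ℝ (EV (n - k)) (DeaffineFiber (k := k) (n := n))),
      ContMDiffVectorBundle ∞ (EV (n - k)) (DeaffineFiber (k := k) (n := n))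
        𝓘(ℝ, GrModel k n) ∧
      (∃ Φ : Diffeomorph (𝓘(ℝ, GrModel k n).prod 𝓘(ℝ, EV (n - k))) 𝓘(ℝ, GraffModel k n)
          (TotalSpace (EV (n - k)) (DeaffineFiber (k := k) (n := n))) (Graff k n) ∞,
        ∀ x, Φ x = graffOfTotal (EV (n - k)) x ∧ deaffine (Φ x) = x.proj) ∧
      -- the bundle is the quotient of the trivial bundle by the tautological bundle
      ∃ (_ : FiberBundle (EV k) (TautFiber (k := k) (n := n)))
        (_ : VectorBundle ℝ (EV k) (TautFiber (k := k) (n := n))),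
        ContMDiffVectorBundle ∞ (EV k) (TautFiber (k := k) (n := n)) 𝓘(ℝ, GrModel k n) ∧
        IsShortExact 𝓘(ℝ, GrModel k n) (EV k) (EV n) (EV (n - k))
          (tautIncl (k := k) (n := n)) (translateFiber (k := k) (n := n)) := by
  exact ⟨graffFiberBundle, graffVectorBundle, graffContMDiffVectorBundle,
    ⟨graffDiffeomorph, fun x => ⟨rfl, deaffine_graffOfTotal x⟩⟩,
    tautFiberBundle, tautVectorBundle, tautContMDiffVectorBundle, isShortExact_taut⟩
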